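/- An SPS lattice is a finite lattice $L$ that is slim (it has no sublattice isomorphic to $\mathsf{M}_3$, the five-element lattice consisting of a zero, a unit and three pairwise incomparable elements), planar (it has a Hasse diagram in the plane, drawn with straight line segments, in which edges meet only at their common end points) and semimodular (if $a \wedge b \prec a$, then $b \prec a \vee b$, where $\prec$ is the covering relation). Let $\operatorname{Con} L$ denote the lattice of all congruences of $L$, ordered by inclusion. Let $L$ be an SPS lattice. (i) If $L$ has more than $2$ elements, then $\operatorname{Con} L$ has at least two dual atoms. (ii) Consequently, $\operatorname{Con} L$ is not isomorphic to the three-element chain and, more generally, it is not isomorphic to any distributive lattice that has more than two elements and exactly one dual atom. -/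

import Mathlib

namespace LatticeCon

variable {L : Type*} [Lattice L]

theorem r_injective : Function.Injective fun α : LatticeCon L => α.r := by
  rintro ⟨⟨r, _⟩, _, _⟩ ⟨⟨s, _⟩, _, _⟩ h
  cases h
  rfl

/-- Congruences are ordered by inclusion. -/
instance instPartialOrder : PartialOrder (LatticeCon L) where
  le α β := ∀ ⦃x y : L⦄, α.r x y → β.r x y
  le_refl _ _ _ h := h
  le_trans _ _ _ h₁ h₂ _ _ h := h₂ (h₁ h)
  le_antisymm α β h₁ h₂ := r_injective (by
    funext x y
    exact propext ⟨fun h => h₁ h, fun h => h₂ h⟩)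

/-- The meet of a set of congruences is their intersection. -/
instance instInfSet : InfSet (LatticeCon L) where
  sInf S :=
    { r := fun x y => ∀ α ∈ S, α.r x y
      iseqv :=
        { refl := fun x α _ => α.iseqv.refl x
          symm := fun h α hα => α.iseqv.symm (h α hα)
          trans := fun h₁ h₂ α hα => α.iseqv.trans (h₁ α hα) (h₂ α hα) }
      inf := fun h₁ h₂ α hα => α.inf (h₁ α hα) (h₂ α hα)
      sup := fun h₁ h₂ α hα => α.sup (h₁ α hα) (h₂ α hα) }

/-- The congruence lattice `Con L`: all congruences of `L`, ordered by inclusion. -/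
instance instCompleteLattice : CompleteLattice (LatticeCon L) where
  __ := completeLatticeOfInf (LatticeCon L) fun _ =>
    ⟨fun α hα _ _ h => h α hα, fun _ hβ _ _ h α hα => hβ hα h⟩
  top :=
    { r := fun _ _ => True
      iseqv := ⟨fun _ => trivial, fun _ => trivial, fun _ _ => trivial⟩
      inf := fun _ _ => trivial
      sup := fun _ _ => trivial }
  le_top _ _ _ _ := trivial
  bot :=
    { r := fun x y => x = y
      iseqv := ⟨fun _ => rfl, fun h => h.symm, fun h₁ h₂ => h₁.trans h₂⟩
      inf := fun h₁ h₂ => by rw [h₁, h₂]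
      sup := fun h₁ h₂ => by rw [h₁, h₂] }
  bot_le α x _ h := h ▸ α.iseqv.refl x

end LatticeCon

/-- A planar (Hasse) diagram of an ordered set: the elements are distinct points of the plane,
larger elements are placed higher, each covering pair is joined by a straight line segment,
an edge passes through no element other than its two ends, and two different edges
do not meet except possibly at an end. -/
structure PlanarDiagram (P : Type*) [PartialOrder P] where
  pos : P → ℝ × ℝ
  pos_injective : Function.Injective pos
  height_lt : ∀ ⦃a b : P⦄, a < b → (pos a).2 < (pos b).2
  eq_or_eq_of_mem_segment : ∀ ⦃a b x : P⦄, a ⋖ b →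
    pos x ∈ segment ℝ (pos a) (pos b) → x = a ∨ x = b
  disjoint_edges : ∀ ⦃a b c d : P⦄, a ⋖ b → c ⋖ d → (a, b) ≠ (c, d) →
    Disjoint (openSegment ℝ (pos a) (pos b)) (openSegment ℝ (pos c) (pos d))

/-- `L` has a sublattice `{o, a, b, c, i}` isomorphic to `M₃`: three distinct elements `a, b, c`,
any two of which meet in `o` and join to `i`. (The five elements are then distinct, and
`a, b, c` are pairwise incomparable.) -/
def HasM3Sublattice (L : Type*) [Lattice L] : Prop :=
  ∃ o a b c i : L, a ≠ b ∧ a ≠ c ∧ b ≠ c ∧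
    a ⊓ b = o ∧ a ⊓ c = o ∧ b ⊓ c = o ∧
    a ⊔ b = i ∧ a ⊔ c = i ∧ b ⊔ c = i

/-- SPS lattices: finite lattices that are slim (no `M₃` sublattice), planar (there is a
planar diagram) and (upper) semimodular. -/
structure IsSPS (L : Type*) [Lattice L] : Prop where
  finite : Finite L
  slim : ¬ HasM3Sublattice L
  planar : Nonempty (PlanarDiagram L)
  semimodular : IsUpperModularLattice L

/-!
A join-prime element `w` yields a congruence with the two classes `{x | w ≤ x}` and
`{x | ¬ w ≤ x}`; it is a dual atom and determines `w`, so two different join-prime elements suffice.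

If `z` had three upper covers, then, by slimness and semimodularity, these would generate a cube
whose edges are coverings. Such a cube has no planar diagram: of the three covers `a`, `b`, `c`,
named from left to right, the edges `z ⋖ a ⋖ a ⊔ c` and `z ⋖ c ⋖ a ⊔ c` enclose a region in which
every upward path through `b` that avoids `a`, `c` and `a ⊔ c` is trapped. So every element has at
most two upper covers. By semimodularity the elements above `z` but not above a cover `w` of `z`
then form a chain, hence `w` is join-prime whenever `z` is comparable to every element. This
applies to two atoms or, if there is only one atom, to this atom and a cover of it.
-/

namespace PlanarDiagram

variable {P : Type*} [PartialOrder P] (d : PlanarDiagram P)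

theorem exists_pos_eq_of_mem_segment {a b u v : P} (hab : a ⋖ b) (huv : u ⋖ v)
    (hne : (a, b) ≠ (u, v)) {r : ℝ × ℝ} (hr : r ∈ segment ℝ (d.pos a) (d.pos b))
    (hr' : r ∈ segment ℝ (d.pos u) (d.pos v)) :
    ∃ x, d.pos x = r ∧ (x = a ∨ x = b) ∧ (x = u ∨ x = v) := by
  have hends : ∀ {x y : P}, r ∈ segment ℝ (d.pos x) (d.pos y) →
      r = d.pos x ∨ r = d.pos y ∨ r ∈ openSegment ℝ (d.pos x) (d.pos y) := by
    intro x y h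
    simpa only [← insert_endpoints_openSegment, Set.mem_insert_iff] using h
  rcases hends hr with rfl | rfl | hopen
  · exact ⟨a, rfl, .inl rfl, d.eq_or_eq_of_mem_segment huv hr'⟩
  · exact ⟨b, rfl, .inr rfl, d.eq_or_eq_of_mem_segment huv hr'⟩
  rcases hends hr' with rfl | rfl | hopen'
  · exact ⟨u, rfl, d.eq_or_eq_of_mem_segment hab hr, .inl rfl⟩
  · exact ⟨v, rfl, d.eq_or_eq_of_mem_segment hab hr, .inr rfl⟩
  · exact (Set.disjoint_left.1 (d.disjoint_edges hab huv hne) hopen hopen').elim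

theorem height_le_of_mem_segment {a b : P} (hab : a < b) {r : ℝ × ℝ}
    (hr : r ∈ segment ℝ (d.pos a) (d.pos b)) : r.2 ≤ (d.pos b).2 :=
  (segment_subset_Icc (d.height_lt hab).le (Prod.segment_subset _ _ hr).2).2

/-- The abscissa, as a function of the height `t`, of the line through two elements of different
heights. -/
noncomputable def abscissa (a b : P) (t : ℝ) : ℝ :=
  AffineMap.lineMap (d.pos a).1 (d.pos b).1 ((t - (d.pos a).2) / ((d.pos b).2 - (d.pos a).2))

theorem continuous_abscissa (a b : P) : Continuous (d.abscissa a b) := by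
  unfold abscissa
  fun_prop

theorem abscissa_left (a b : P) : d.abscissa a b (d.pos a).2 = (d.pos a).1 := by
  simp [abscissa]

theorem abscissa_right {a b : P} (hab : a < b) : d.abscissa a b (d.pos b).2 = (d.pos b).1 := by
  rw [abscissa, div_self (sub_pos.2 (d.height_lt hab)).ne', AffineMap.lineMap_apply_one]

theorem abscissa_mem_segment {a b : P} (hab : a < b) {t : ℝ} (hat : (d.pos a).2 ≤ t)
    (htb : t ≤ (d.pos b).2) : (d.abscissa a b t, t) ∈ segment ℝ (d.pos a) (d.pos b) := by
  have hpos : 0 < (d.pos b).2 - (d.pos a).2 := sub_pos.2 (d.height_lt hab)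
  have hmem : (t - (d.pos a).2) / ((d.pos b).2 - (d.pos a).2) ∈ Set.Icc (0 : ℝ) 1 :=
    ⟨div_nonneg (by linarith) hpos.le, (div_le_one hpos).2 (by linarith)⟩
  convert lineMap_mem_segment ℝ (d.pos a) (d.pos b) hmem using 1
  ext
  · simp [abscissa, AffineMap.lineMap_apply]
  · simp [AffineMap.lineMap_apply, hpos.ne']

/-- The abscissa, as a function of the height, of the polygonal line with vertices `x :: l`.
It describes that line at heights between those of its ends when `x :: l` is a chain of covers;
above the last vertex it is constant. -/
noncomputable def polyline : P → List P → ℝ → ℝ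
  | x, [], _ => (d.pos x).1
  | x, y :: l, t => if t ≤ (d.pos y).2 then d.abscissa x y t else polyline y l t

theorem polyline_cons_of_le (x : P) {y : P} (l : List P) {t : ℝ} (ht : t ≤ (d.pos y).2) :
    d.polyline x (y :: l) t = d.abscissa x y t :=
  if_pos ht

theorem polyline_cons_of_lt (x : P) {y : P} (l : List P) {t : ℝ} (ht : (d.pos y).2 < t) :
    d.polyline x (y :: l) t = d.polyline y l t :=
  if_neg ht.not_ge

theorem polyline_height_head {x : P} {l : List P} (h : (x :: l).IsChain (· ⋖ ·)) :
    d.polyline x l (d.pos x).2 = (d.pos x).1 := by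
  cases l with
  | nil => rfl
  | cons y l =>
    rw [d.polyline_cons_of_le x l (d.height_lt (List.isChain_cons_cons.1 h).1.lt).le,
      d.abscissa_left]

theorem continuous_polyline {x : P} {l : List P} (h : (x :: l).IsChain (· ⋖ ·)) :
    Continuous (d.polyline x l) := by
  induction l generalizing x with
  | nil => exact continuous_const
  | cons y l ih =>
    obtain ⟨hxy, hl⟩ := List.isChain_cons_cons.1 h
    refine Continuous.if_le (d.continuous_abscissa x y) (ih hl) continuous_id continuous_const ?_
    rintro t rfl
    rw [d.abscissa_right hxy.lt, d.polyline_height_head hl]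

theorem exists_covBy_polyline_mem_segment {x : P} {l : List P} (h : (x :: l).IsChain (· ⋖ ·))
    {t : ℝ} (hxt : (d.pos x).2 < t) (htl : t ≤ (d.pos (l.getLastD x)).2) :
    ∃ u ∈ x :: l, ∃ v ∈ x :: l, u ⋖ v ∧
      (d.polyline x l t, t) ∈ segment ℝ (d.pos u) (d.pos v) := by
  induction l generalizing x with
  | nil => exact (hxt.not_ge htl).elim
  | cons y l ih =>
    obtain ⟨hxy, hl⟩ := List.isChain_cons_cons.1 h
    rcases le_or_gt t (d.pos y).2 with hty | hyt
    · refine ⟨x, by simp, y, by simp, hxy, ?_⟩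
      rw [d.polyline_cons_of_le x l hty]
      exact d.abscissa_mem_segment hxy.lt hxt.le hty
    · rw [d.polyline_cons_of_lt x l hyt]
      obtain ⟨u, hu, v, hv, huv⟩ := ih hl hyt (by rwa [List.getLastD_cons] at htl)
      exact ⟨u, List.mem_cons_of_mem x hu, v, List.mem_cons_of_mem x hv, huv⟩

theorem polyline_ne_polyline {x y : P} {l m : List P} (hl : (x :: l).IsChain (· ⋖ ·))
    (hm : (y :: m).IsChain (· ⋖ ·)) {t : ℝ} (hxt : (d.pos x).2 < t) (hyt : (d.pos y).2 < t)
    (htl : t ≤ (d.pos (l.getLastD x)).2) (htm : t ≤ (d.pos (m.getLastD y)).2)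
    (hcommon : ∀ v ∈ x :: l, v ∈ y :: m → (d.pos v).2 < t) :
    d.polyline x l t ≠ d.polyline y m t := by
  intro heq
  obtain ⟨a, ha, b, hb, hab, hr⟩ := d.exists_covBy_polyline_mem_segment hl hxt htl
  obtain ⟨u, hu, v, hv, huv, hr'⟩ := d.exists_covBy_polyline_mem_segment hm hyt htm
  rw [← heq] at hr'
  by_cases hedge : (a, b) = (u, v)
  · obtain ⟨-, rfl⟩ := Prod.mk.inj hedge
    exact (hcommon b hb hv).not_ge (d.height_le_of_mem_segment hab.lt hr)
  · obtain ⟨w, hw, hwab, hwuv⟩ := d.exists_pos_eq_of_mem_segment hab huv hedge hr hr'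
    have hwl : w ∈ x :: l := by rcases hwab with rfl | rfl <;> assumption
    have hwm : w ∈ y :: m := by rcases hwuv with rfl | rfl <;> assumption
    exact (hcommon w hwl hwm).ne (congrArg Prod.snd hw)

theorem polyline_lt_polyline {x y : P} {l m : List P} (hl : (x :: l).IsChain (· ⋖ ·))
    (hm : (y :: m).IsChain (· ⋖ ·)) {s t : ℝ} (hst : s ≤ t) (hxs : (d.pos x).2 < s)
    (hys : (d.pos y).2 < s) (htl : t ≤ (d.pos (l.getLastD x)).2)
    (htm : t ≤ (d.pos (m.getLastD y)).2)
    (hcommon : ∀ v ∈ x :: l, v ∈ y :: m → (d.pos v).2 < s)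
    (hlt : d.polyline x l s < d.polyline y m s) : d.polyline x l t < d.polyline y m t := by
  by_contra! hge
  obtain ⟨r, ⟨hsr, hrt⟩, hr⟩ : ∃ r ∈ Set.Icc s t, d.polyline x l r = d.polyline y m r :=
    isPreconnected_Icc.intermediate_value₂ (Set.left_mem_Icc.2 hst) (Set.right_mem_Icc.2 hst)
      (d.continuous_polyline hl).continuousOn (d.continuous_polyline hm).continuousOn hlt.le hge
  exact d.polyline_ne_polyline hl hm (hxs.trans_le hsr) (hys.trans_le hsr) (hrt.trans htl)
    (hrt.trans htm) (fun v hv hv' => (hcommon v hv hv').trans_le hsr) hr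

theorem abscissa_ne_abscissa {z a b : P} (hza : z ⋖ a) (hzb : z ⋖ b) (hab : a ≠ b) {t : ℝ}
    (hzt : (d.pos z).2 < t) (hta : t ≤ (d.pos a).2) (htb : t ≤ (d.pos b).2) :
    d.abscissa z a t ≠ d.abscissa z b t := by
  rw [← d.polyline_cons_of_le z [] hta, ← d.polyline_cons_of_le z [] htb]
  refine d.polyline_ne_polyline (by simpa using hza) (by simpa using hzb) hzt hzt hta htb ?_
  intro v hva hvb
  obtain rfl : v = z := by grind
  exact hzt

theorem not_abscissa_between {z a b c p : P} {l : List P} (hza : z ⋖ a) (hap : a ⋖ p)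
    (hzc : z ⋖ c) (hcp : c ⋖ p) (hl : (z :: b :: l).IsChain (· ⋖ ·)) (ha : a ∉ b :: l)
    (hc : c ∉ b :: l) (hp : p ∉ b :: l) (hpl : (d.pos p).2 ≤ (d.pos (l.getLastD b)).2) {t : ℝ}
    (hzt : (d.pos z).2 < t) (hta : t ≤ (d.pos a).2) (htb : t ≤ (d.pos b).2)
    (htc : t ≤ (d.pos c).2) (hlt : d.abscissa z a t < d.abscissa z b t) :
    ¬ d.abscissa z b t < d.abscissa z c t := by
  intro hlt'
  have hchain : ∀ {x : P}, z ⋖ x → x ⋖ p → [z, x, p].IsChain (· ⋖ ·) := by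
    intro x hzx hxp
    simp [hzx, hxp]
  have hcommon : ∀ {x : P}, x ∉ b :: l → ∀ v ∈ [z, x, p], v ∈ z :: b :: l → (d.pos v).2 < t := by
    intro x hx v hv hv'
    obtain rfl : v = z := by grind
    exact hzt
  have hend : ∀ {x : P}, x ⋖ p → d.polyline z [x, p] (d.pos p).2 = (d.pos p).1 := by
    intro x hxp
    rw [d.polyline_cons_of_lt z [p] (d.height_lt hxp.lt), d.polyline_cons_of_le x [] le_rfl,
      d.abscissa_right hxp.lt]
  have htp : t ≤ (d.pos p).2 := hta.trans (d.height_lt hap.lt).le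
  -- At the height of `p` the paths through `a` and `c` meet, with the chain `z :: b :: l` between.
  have hleft : d.polyline z [a, p] (d.pos p).2 < d.polyline z (b :: l) (d.pos p).2 :=
    d.polyline_lt_polyline (hchain hza hap) hl htp hzt hzt le_rfl (by rwa [List.getLastD_cons])
      (hcommon ha) (by rwa [d.polyline_cons_of_le z [p] hta, d.polyline_cons_of_le z l htb])
  have hright : d.polyline z (b :: l) (d.pos p).2 < d.polyline z [c, p] (d.pos p).2 :=
    d.polyline_lt_polyline hl (hchain hzc hcp) htp hzt hzt (by rwa [List.getLastD_cons]) le_rfl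
      (fun v hv hv' => hcommon hc v hv' hv)
      (by rwa [d.polyline_cons_of_le z [p] htc, d.polyline_cons_of_le z l htb])
  exact (hleft.trans hright).ne ((hend hap).trans (hend hcp).symm)

end PlanarDiagram

theorem PlanarDiagram.false_of_cube {P : Type*} [PartialOrder P] (d : PlanarDiagram P) {z i : P}
    {a p : Fin 3 → P} (hza : ∀ j, z ⋖ a j) (hap : ∀ j k, j ≠ k → a j ⋖ p k) (hpi : ∀ k, p k ⋖ i)
    (ha : Function.Injective a) (hp : Function.Injective p) : False := by
  obtain ⟨j₀, hj₀⟩ := Finite.exists_min fun j => (d.pos (a j)).2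
  set t := (d.pos (a j₀)).2
  have hzt : (d.pos z).2 < t := d.height_lt (hza j₀).lt
  have hinj : Function.Injective fun j => d.abscissa z (a j) t := by
    intro j k hjk
    by_contra hne
    exact d.abscissa_ne_abscissa (hza j) (hza k) (ha.ne hne) hzt (hj₀ j) (hj₀ k) hjk
  set σ := Tuple.sort fun j => d.abscissa z (a j) t
  have hσ : StrictMono fun j => d.abscissa z (a (σ j)) t :=
    (Tuple.monotone_sort _).strictMono_of_injective (hinj.comp σ.injective)
  have hne_ap : ∀ {j k}, a j ≠ p k := by
    intro j k h
    obtain ⟨l, hl⟩ := exists_ne k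
    exact (hza j).2 (hza l).lt (h ▸ (hap l k hl).lt)
  have hne_ai : ∀ j, a j ≠ i := by
    intro j h
    obtain ⟨k, hk⟩ := exists_ne j
    exact ((hap j k hk.symm).lt.trans (hpi k).lt).ne h
  refine d.not_abscissa_between (a := a (σ 0)) (b := a (σ 1)) (c := a (σ 2)) (p := p (σ 1))
    (l := [p (σ 0), i]) (hza _) (hap _ _ (by simp)) (hza _) (hap _ _ (by simp)) ?_ ?_ ?_ ?_
    (d.height_lt (hpi _).lt).le hzt (hj₀ _) (hj₀ _) (hj₀ _)
    (hσ (show (0 : Fin 3) < 1 by decide)) (hσ (show (1 : Fin 3) < 2 by decide))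
  · simp [hza, hap, hpi]
  · simp [ha.eq_iff, hne_ap, hne_ai]
  · simp [ha.eq_iff, hne_ap, hne_ai]
  · simp [hp.eq_iff, hne_ap.symm, (hpi _).ne]

/-- Every element has at most two upper covers, the local form in which slimness and planarity of
a semimodular lattice are used. -/
def AtMostTwoUpperCovers (P : Type*) [Preorder P] : Prop :=
  ∀ ⦃z a b c : P⦄, z ⋖ a → z ⋖ b → z ⋖ c → a = b ∨ a = c ∨ b = c

section UpperCovers

variable {L : Type*} [Lattice L]

theorem covBy_sup_left_of_covBy [IsWeakUpperModularLattice L] {z a b : L} (ha : z ⋖ a)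
    (hb : z ⋖ b) (hab : a ≠ b) : a ⋖ a ⊔ b := by
  have hinf : a ⊓ b = z := ha.wcovBy.inf_eq hb.wcovBy hab
  exact covBy_sup_of_inf_covBy_of_inf_covBy_left (by rwa [hinf]) (by rwa [hinf])

theorem sup_covBy_sup_sup_of_covBy [IsWeakUpperModularLattice L] {z a b c : L} (ha : z ⋖ a)
    (hb : z ⋖ b) (hc : z ⋖ c) (hab : a ≠ b) (hac : a ≠ c) (hne : a ⊔ b ≠ a ⊔ c) :
    a ⊔ b ⋖ a ⊔ b ⊔ c := by
  have hcov : a ⊔ b ⋖ (a ⊔ b) ⊔ (a ⊔ c) :=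
    covBy_sup_left_of_covBy (covBy_sup_left_of_covBy ha hb hab)
      (covBy_sup_left_of_covBy ha hc hac) hne
  rwa [← sup_sup_distrib_left, ← sup_assoc] at hcov

theorem hasM3Sublattice_of_sup_eq_sup [IsWeakUpperModularLattice L] {z a b c : L} (ha : z ⋖ a)
    (hb : z ⋖ b) (hc : z ⋖ c) (hab : a ≠ b) (hac : a ≠ c) (hbc : b ≠ c)
    (h : a ⊔ b = a ⊔ c) : HasM3Sublattice L := by
  have hle : b ⊔ c ≤ a ⊔ b := sup_le le_sup_right (h ▸ le_sup_right)
  have hcov : b ⋖ a ⊔ b := sup_comm b a ▸ covBy_sup_left_of_covBy hb ha hab.symm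
  have heq : b ⊔ c = a ⊔ b := (hcov.eq_or_eq le_sup_left hle).resolve_left
    (covBy_sup_left_of_covBy hb hc hbc).ne'
  exact ⟨z, a, b, c, a ⊔ b, hab, hac, hbc, ha.wcovBy.inf_eq hb.wcovBy hab,
    ha.wcovBy.inf_eq hc.wcovBy hac, hb.wcovBy.inf_eq hc.wcovBy hbc, rfl, h.symm, heq⟩

theorem PlanarDiagram.atMostTwoUpperCovers [IsWeakUpperModularLattice L] (d : PlanarDiagram L)
    (hslim : ¬ HasM3Sublattice L) : AtMostTwoUpperCovers L := by
  intro z a b c ha hb hc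
  by_contra! h
  obtain ⟨hab, hac, hbc⟩ := h
  have hab_ac : a ⊔ b ≠ a ⊔ c := fun h =>
    hslim (hasM3Sublattice_of_sup_eq_sup ha hb hc hab hac hbc h)
  have hba_bc : b ⊔ a ≠ b ⊔ c := fun h =>
    hslim (hasM3Sublattice_of_sup_eq_sup hb ha hc hab.symm hbc hac h)
  have hca_cb : c ⊔ a ≠ c ⊔ b := fun h =>
    hslim (hasM3Sublattice_of_sup_eq_sup hc ha hb hac.symm hbc.symm hab h)
  have hcov_ab := sup_covBy_sup_sup_of_covBy ha hb hc hab hac hab_ac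
  have hcov_bc := sup_covBy_sup_sup_of_covBy hb hc ha hbc hab.symm hba_bc.symm
  have hcov_ca := sup_covBy_sup_sup_of_covBy hc ha hb hac.symm hbc.symm hca_cb
  rw [show b ⊔ c ⊔ a = a ⊔ b ⊔ c by ac_rfl] at hcov_bc
  rw [show c ⊔ a ⊔ b = a ⊔ b ⊔ c by ac_rfl] at hcov_ca
  refine d.false_of_cube (z := z) (i := a ⊔ b ⊔ c) (a := ![a, b, c]) (p := ![b ⊔ c, c ⊔ a, a ⊔ b])
    ?_ ?_ ?_ ?_ ?_
  · simp [Fin.forall_fin_succ, ha, hb, hc]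
  · have hsup {x y : L} (hx : z ⋖ x) (hy : z ⋖ y) (hxy : x ≠ y) : x ⋖ x ⊔ y ∧ y ⋖ x ⊔ y :=
      ⟨covBy_sup_left_of_covBy hx hy hxy, sup_comm y x ▸ covBy_sup_left_of_covBy hy hx hxy.symm⟩
    simp [Fin.forall_fin_succ, hsup ha hb hab, hsup hb hc hbc, hsup hc ha hac.symm]
  · simp [Fin.forall_fin_succ, hcov_ab, hcov_bc, hcov_ca]
  · simp [Function.Injective, Fin.forall_fin_succ, hab, hac, hbc, hab.symm, hac.symm, hbc.symm]
  · rw [sup_comm b a] at hba_bc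
    rw [sup_comm c b] at hca_cb
    rw [sup_comm a c] at hab_ac
    simp [Function.Injective, Fin.forall_fin_succ, hab_ac, hba_bc, hca_cb, hab_ac.symm,
      hba_bc.symm, hca_cb.symm]

theorem le_total_of_not_le_of_covBy [IsUpperModularLattice L] [IsStronglyAtomic L]
    (hL : AtMostTwoUpperCovers L) {z w x y : L} (hzw : z ⋖ w) (hzx : z ≤ x) (hzy : z ≤ y)
    (hwx : ¬ w ≤ x) (hwy : ¬ w ≤ y) : x ≤ y ∨ y ≤ x := by
  by_contra! h
  obtain ⟨x', hx', hx'x⟩ := exists_covBy_le_of_lt (inf_lt_left.2 h.1)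
  obtain ⟨y', hy', hy'y⟩ := exists_covBy_le_of_lt (inf_lt_right.2 h.2)
  have hinf : w ⊓ (x ⊓ y) = z :=
    (hzw.eq_or_eq (le_inf hzw.le (le_inf hzx hzy)) inf_le_left).resolve_right fun hw =>
      hwx ((inf_eq_left.1 hw).trans inf_le_left)
  have hw' : x ⊓ y ⋖ w ⊔ (x ⊓ y) := covBy_sup_of_inf_covBy_left (by rwa [hinf])
  rcases hL hx' hy' hw' with rfl | rfl | rfl
  · exact hx'.lt.not_ge (le_inf hx'x hy'y)
  · exact hwx (le_sup_left.trans hx'x)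
  · exact hwy (le_sup_left.trans hy'y)

theorem supPrime_of_covBy_of_forall_le_or_ge [IsUpperModularLattice L] [IsStronglyAtomic L]
    (hL : AtMostTwoUpperCovers L) {z w : L} (hzw : z ⋖ w) (hz : ∀ x, x ≤ z ∨ z ≤ x) :
    SupPrime w := by
  refine ⟨fun hmin => hzw.lt.not_ge (hmin hzw.le), fun x y hw => ?_⟩
  by_contra! hn
  have hsup : ¬ (x ≤ y ∨ y ≤ x) := by
    rintro (h | h)
    · exact hn.2 (by rwa [sup_eq_right.2 h] at hw)
    · exact hn.1 (by rwa [sup_eq_left.2 h] at hw)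
  rcases hz x, hz y with ⟨hx | hx, hy | hy⟩
  · exact hzw.lt.not_ge (hw.trans (sup_le hx hy))
  · exact hsup (.inl (hx.trans hy))
  · exact hsup (.inr (hy.trans hx))
  · exact hsup (le_total_of_not_le_of_covBy hL hzw hx hy hn.1 hn.2)

theorem exists_supPrime_ne_supPrime [OrderBot L] [IsUpperModularLattice L] [IsStronglyAtomic L]
    (hL : AtMostTwoUpperCovers L) (hcard : 2 < ENat.card L) :
    ∃ w w' : L, w ≠ w' ∧ SupPrime w ∧ SupPrime w' := by
  have hthird := ENat.exists_ne_ne_of_three_le (Order.add_one_le_of_lt hcard)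
  obtain ⟨x, hx, -⟩ := hthird ⊥ ⊥
  obtain ⟨w, hw, -⟩ := exists_covBy_le_of_lt (bot_lt_iff_ne_bot.2 hx)
  have hprime {w : L} (hw : ⊥ ⋖ w) : SupPrime w :=
    supPrime_of_covBy_of_forall_le_or_ge hL hw fun _ => .inr bot_le
  by_cases hatom : ∃ w', ⊥ ⋖ w' ∧ w ≠ w'
  · obtain ⟨w', hw', hne⟩ := hatom
    exact ⟨w, w', hne, hprime hw, hprime hw'⟩
  push Not at hatom
  have hle : ∀ x, x ≠ ⊥ → w ≤ x := by
    intro x hx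
    obtain ⟨w', hw', hw'x⟩ := exists_covBy_le_of_lt (bot_lt_iff_ne_bot.2 hx)
    exact hatom w' hw' ▸ hw'x
  obtain ⟨y, hy, hyw⟩ := hthird ⊥ w
  obtain ⟨w', hw', -⟩ := exists_covBy_le_of_lt ((hle y hy).lt_of_ne hyw.symm)
  refine ⟨w, w', hw'.ne, hprime hw, supPrime_of_covBy_of_forall_le_or_ge hL hw' fun x => ?_⟩
  rcases eq_or_ne x ⊥ with rfl | hx
  · exact .inl bot_le
  · exact .inr (hle x hx)

end UpperCovers

section Congruences

variable {L : Type*} [Lattice L]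

theorem isCoatom_ker {M : Type*} [Lattice M] [BoundedOrder M] [IsSimpleOrder M]
    {f : LatticeHom L M} (hf : Function.Surjective f) : IsCoatom (LatticeCon.ker f) := by
  refine ⟨fun htop => ?_, fun β hβ => top_le_iff.1 fun u v _ => ?_⟩
  · obtain ⟨x, hx⟩ := hf ⊥
    obtain ⟨y, hy⟩ := hf ⊤
    have hxy : (LatticeCon.ker f).r x y := htop ▸ trivial
    exact bot_ne_top (hx.symm.trans (Eq.trans hxy hy))
  · have hker : ∀ {x y}, f x = f y → β.r x y := fun h => hβ.le h
    obtain ⟨x, y, hxy, hne⟩ : ∃ x y, β.r x y ∧ f x ≠ f y := by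
      by_contra! h
      exact hβ.not_ge h
    have hval : ∀ {s}, f s = f x ∨ f s = f y := by
      intro s
      rcases eq_bot_or_eq_top (f s) with h | h <;> rcases eq_bot_or_eq_top (f x) with h' | h' <;>
        rcases eq_bot_or_eq_top (f y) with h'' | h'' <;> simp_all
    have hβx : ∀ s, β.r s x := fun s =>
      hval.elim hker fun h => β.iseqv.trans (hker h) (β.iseqv.symm hxy)
    exact β.iseqv.trans (hβx u) (β.iseqv.symm (hβx v))

/-- The homomorphism onto the two-element lattice `Prop` sending the principal filter of a
join-prime element `w` to `True` and its complement to `False`. Its kernel is a dual atom of the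
congruence lattice. -/
def supPrimeHom {w : L} (hw : SupPrime w) : LatticeHom L Prop where
  toFun x := w ≤ x
  map_sup' _ _ := propext hw.le_sup
  map_inf' _ _ := propext le_inf_iff

theorem ker_supPrimeHom_r {w : L} (hw : SupPrime w) {x y : L} :
    (LatticeCon.ker (supPrimeHom hw)).r x y ↔ (w ≤ x ↔ w ≤ y) :=
  eq_iff_iff

theorem supPrimeHom_surjective {w : L} (hw : SupPrime w) :
    Function.Surjective (supPrimeHom hw) := by
  intro q
  by_cases hq : q
  · exact ⟨w, propext (iff_of_true le_rfl hq)⟩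
  · obtain ⟨z, hz⟩ := not_isMin_iff.1 hw.not_isMin
    exact ⟨z, propext (iff_of_false hz.not_ge hq)⟩

theorem eq_of_ker_supPrimeHom_eq {w w' : L} {hw : SupPrime w} {hw' : SupPrime w'}
    (h : LatticeCon.ker (supPrimeHom hw) = LatticeCon.ker (supPrimeHom hw')) : w = w' := by
  obtain ⟨z, hz⟩ := not_isMin_iff.1 hw.not_isMin
  obtain ⟨z', hz'⟩ := not_isMin_iff.1 hw'.not_isMin
  have hclass : ∀ x, (w ≤ z ⊓ z' ↔ w ≤ x) ↔ (w' ≤ z ⊓ z' ↔ w' ≤ x) := by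
    intro x
    have hr : (LatticeCon.ker (supPrimeHom hw)).r (z ⊓ z') x ↔
        (LatticeCon.ker (supPrimeHom hw')).r (z ⊓ z') x := by rw [h]
    rwa [ker_supPrimeHom_r, ker_supPrimeHom_r] at hr
  have hw_not : ¬ w ≤ z ⊓ z' := fun h => hz.not_ge (h.trans inf_le_left)
  have hw'_not : ¬ w' ≤ z ⊓ z' := fun h => hz'.not_ge (h.trans inf_le_right)
  have hiff : ∀ x, w ≤ x ↔ w' ≤ x := fun x => by
    simpa only [hw_not, hw'_not, false_iff, not_iff_not] using hclass x
  exact eq_of_forall_ge_iff hiff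

theorem exists_isCoatom_ne_isCoatom [OrderBot L] [IsUpperModularLattice L] [IsStronglyAtomic L]
    (hL : AtMostTwoUpperCovers L) (hcard : 2 < ENat.card L) :
    ∃ α β : LatticeCon L, α ≠ β ∧ IsCoatom α ∧ IsCoatom β := by
  obtain ⟨w, w', hne, hw, hw'⟩ := exists_supPrime_ne_supPrime hL hcard
  exact ⟨_, _, fun h => hne (eq_of_ker_supPrimeHom_eq h),
    isCoatom_ker (supPrimeHom_surjective hw), isCoatom_ker (supPrimeHom_surjective hw')⟩

theorem two_lt_card_of_ne_bot_of_ne_top {α : LatticeCon L} (hbot : α ≠ ⊥) (htop : α ≠ ⊤) :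
    2 < ENat.card L := by
  obtain ⟨x, y, hxy, hne⟩ : ∃ x y, α.r x y ∧ x ≠ y := by
    by_contra! h
    exact hbot (le_bot_iff.1 h)
  obtain ⟨s, hs⟩ : ∃ s, ¬ α.r s x := by
    by_contra! h
    exact htop (top_le_iff.1 fun u v _ => α.iseqv.trans (h u) (α.iseqv.symm (h v)))
  have hsx : s ≠ x := by
    rintro rfl
    exact hs (α.iseqv.refl s)
  have hsy : s ≠ y := by
    rintro rfl
    exact hs (α.iseqv.symm hxy)
  calc (2 : ℕ∞) < 3 := by norm_num
    _ = ({s, x, y} : Set L).encard := (Set.encard_eq_three.2 ⟨s, x, y, hsx, hsy, hne, rfl⟩).symm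
    _ ≤ ENat.card L := Set.encard_le_card

theorem two_lt_card_of_two_lt_card_latticeCon (hcard : 2 < ENat.card (LatticeCon L)) :
    2 < ENat.card L := by
  obtain ⟨α, hbot, htop⟩ :=
    ENat.exists_ne_ne_of_three_le (Order.add_one_le_of_lt hcard) (⊥ : LatticeCon L) ⊤
  exact two_lt_card_of_ne_bot_of_ne_top hbot htop

theorem isEmpty_orderIso_of_existsUnique_isCoatom {D : Type*} [PartialOrder D] [OrderTop D]
    (hL : 2 < ENat.card L → ∃ α β : LatticeCon L, α ≠ β ∧ IsCoatom α ∧ IsCoatom β)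
    (hD : 2 < ENat.card D) (hunique : ∃! d : D, IsCoatom d) : IsEmpty (LatticeCon L ≃o D) := by
  refine ⟨fun e => ?_⟩
  obtain ⟨α, β, hne, hα, hβ⟩ :=
    hL (two_lt_card_of_two_lt_card_latticeCon (by rwa [ENat.card_congr e.toEquiv]))
  exact hne (e.injective (hunique.unique ((e.isCoatom_iff α).2 hα) ((e.isCoatom_iff β).2 hβ)))

end Congruences

theorem proposition1_general (L : Type*) [Lattice L] [WellFoundedLT L] [IsUpperModularLattice L]
    (hL : AtMostTwoUpperCovers L) :
    (2 < ENat.card L → ∃ α β : LatticeCon L, α ≠ β ∧ IsCoatom α ∧ IsCoatom β) ∧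
    IsEmpty (LatticeCon L ≃o Fin 3) ∧
    ∀ (D : Type*) [PartialOrder D] [OrderTop D],
      2 < ENat.card D → (∃! d : D, IsCoatom d) → IsEmpty (LatticeCon L ≃o D) := by
  have htwo (hcard : 2 < ENat.card L) :
      ∃ α β : LatticeCon L, α ≠ β ∧ IsCoatom α ∧ IsCoatom β := by
    have : Nonempty L :=
      ((ENat.one_lt_card_iff_nontrivial L).1 (one_le_two.trans_lt hcard)).to_nonempty
    obtain ⟨o, ho⟩ := exists_minimal_of_wellFoundedLT (fun _ : L => True) (by simp)
    let : OrderBot L := { bot := o, bot_le := (minimal_true.1 ho).isBot }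
    exact exists_isCoatom_ne_isCoatom hL hcard
  have hthree : 2 < ENat.card (Fin 3) := by
    rw [ENat.card_eq_coe_fintype_card, Fintype.card_fin]
    norm_num
  have hcoatom : ∃! d : Fin 3, IsCoatom d := by
    refine ⟨1, ⟨by decide, by decide⟩, ?_⟩
    rintro x ⟨h₁, h₂⟩
    revert x
    decide
  exact ⟨htwo, isEmpty_orderIso_of_existsUnique_isCoatom htwo hthree hcoatom,
    fun D _ _ => isEmpty_orderIso_of_existsUnique_isCoatom htwo⟩

theorem proposition1 (L : Type*) [Lattice L] (hL : IsSPS L) :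
    (2 < Nat.card L → ∃ α β : LatticeCon L, α ≠ β ∧ IsCoatom α ∧ IsCoatom β) ∧
    IsEmpty (LatticeCon L ≃o Fin 3) ∧
    ∀ (D : Type*) [DistribLattice D] [OrderTop D],
      2 < ENat.card D → (∃! d : D, IsCoatom d) → IsEmpty (LatticeCon L ≃o D) := by
  obtain ⟨_, hslim, ⟨d⟩, _⟩ := hL
  obtain ⟨htwo, hchain, hD⟩ := proposition1_general L (d.atMostTwoUpperCovers hslim)
  exact ⟨by simpa [ENat.card_eq_coe_natCard] using htwo, hchain, fun D _ _ => hD D⟩
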